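/- For a finite-dimensional complex Euclidean space $\mathcal{V}$ let $\mathcal{M}(\mathcal{V})$ be the space of linear operators on $\mathcal{V}$. A subchannel from $\mathcal{V}$ to $\mathcal{W}$ is a completely positive, trace non-increasing linear map $\mathcal{M}(\mathcal{V})\to\mathcal{M}(\mathcal{W})$; a channel is a completely positive, trace-preserving one. A channel $\mathcal{E}$ on $\mathcal{Y}$ is probabilistically correctable for $\mathcal{X}$ if there are subchannels $\mathcal{S}$ from $\mathcal{X}$ to $\mathcal{Y}$ and $\mathcal{R}$ from $\mathcal{Y}$ to $\mathcal{X}$ such that $\mathcal{R}\mathcal{E}\mathcal{S}\neq 0$ and $\mathcal{R}\mathcal{E}\mathcal{S}$ is a scalar multiple of the identity map of $\mathcal{M}(\mathcal{X})$; it is perfectly correctable for $\mathcal{X}$ if $\mathcal{S},\mathcal{R}$ can be chosen so that $\mathcal{R}\mathcal{E}\mathcal{S}$ equals the identity map. **Theorem.** Let $\mathcal{X},\mathcal{Y}$ be finite-dimensional complex Euclidean spaces with $\dim\mathcal{X}\ge 2$, let $r\ge 1$ be an integer, and let $G_1,\dots,G_r$ be independent random Ginibre matrices on $\mathcal{Y}$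 (the entries of each are independent and have the standard complex normal distribution). Put $Q=\sum_{i=1}^r G_i^\dagger G_i$ and let $\mathcal{E}_r$ be the random map $$\mathcal{E}_r(A)=\sum_{i=1}^r \bigl(G_iQ^{-1/2}\bigr)\,A\,\bigl(G_iQ^{-1/2}\bigr)^\dagger ,\qquad A\in\mathcal{M}(\mathcal{Y}),$$ where the inverse is the Moore-Penrose pseudo-inverse if $Q$ is singular (an event of probability zero). Then the following two implications hold. 1. If $r<\dfrac{\dim(\mathcal{X})\dim(\mathcal{Y})}{\dim(\mathcal{X})^2-1}$, then almost surely $\mathcal{E}_r$ is a channel that is probabilistically correctable for $\mathcal{X}$. 2. If almost surely $\mathcal{E}_r$ is a channel that is perfectly correctable for $\mathcal{X}$, then $r<\sqrt{\dfrac{\dim(\mathcal{Y})}{\dim(\mathcal{X})-1}}$. -/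

import Mathlib

open MeasureTheory ProbabilityTheory
open scoped Matrix ComplexOrder NNReal

noncomputable section

/-- Density operators on `ℂ^X`: positive semidefinite with unit trace. -/
def IsDensity {X : Type*} [Fintype X] (ρ : Matrix X X ℂ) : Prop :=
  ρ.PosSemidef ∧ ρ.trace = 1

/-- The action of `Φ ⊗ id` on operators on `ℂ^X ⊗ ℂ^Z`, with `Φ : M(ℂ^X) → M(ℂ^Y)`: the map `Φ` is
applied to each block `(Q (i, k) (j, l))_{i, j}`. -/
def tensorId {X Y Z : Type*} (Φ : Matrix X X ℂ →ₗ[ℂ] Matrix Y Y ℂ)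
    (Q : Matrix (X × Z) (X × Z) ℂ) : Matrix (Y × Z) (Y × Z) ℂ :=
  Matrix.of fun a b => Φ (Matrix.of fun i j => Q (i, a.2) (j, b.2)) a.1 b.1

/-- Complete positivity: `Φ ⊗ id_X` maps positive semidefinite operators on `ℂ^X ⊗ ℂ^X` to positive
semidefinite operators on `ℂ^Y ⊗ ℂ^X`. -/
def IsCompletelyPositive {X Y : Type*} (Φ : Matrix X X ℂ →ₗ[ℂ] Matrix Y Y ℂ) : Prop :=
  ∀ Q : Matrix (X × X) (X × X) ℂ, Q.PosSemidef → (tensorId Φ Q).PosSemidef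

/-- Quantum subchannels: completely positive and trace non-increasing maps. (For a completely
positive map the trace below is real.) -/
def IsSubchannel {X Y : Type*} [Fintype X] [Fintype Y]
    (Φ : Matrix X X ℂ →ₗ[ℂ] Matrix Y Y ℂ) : Prop :=
  IsCompletelyPositive Φ ∧ ∀ ρ, IsDensity ρ → (Φ ρ).trace.re ≤ 1

/-- Quantum channels: completely positive and trace preserving maps. -/
def IsChannel {X Y : Type*} [Fintype X] [Fintype Y]
    (Φ : Matrix X X ℂ →ₗ[ℂ] Matrix Y Y ℂ) : Prop :=
  IsCompletelyPositive Φ ∧ ∀ ρ, IsDensity ρ → (Φ ρ).trace = 1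

/-- The channels on `ℂ^Y` that are probabilistically correctable for `ℂ^X`. -/
def probCorrectable (X Y : Type*) [Fintype X] [Fintype Y] :
    Set (Matrix Y Y ℂ →ₗ[ℂ] Matrix Y Y ℂ) :=
  {E | IsChannel E ∧ ∃ (S : Matrix X X ℂ →ₗ[ℂ] Matrix Y Y ℂ) (R : Matrix Y Y ℂ →ₗ[ℂ] Matrix X X ℂ),
    IsSubchannel S ∧ IsSubchannel R ∧ R ∘ₗ E ∘ₗ S ≠ 0 ∧
      ∃ p : ℂ, R ∘ₗ E ∘ₗ S = p • LinearMap.id}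

/-- The channels on `ℂ^Y` that are perfectly correctable for `ℂ^X`. -/
def perfCorrectable (X Y : Type*) [Fintype X] [Fintype Y] :
    Set (Matrix Y Y ℂ →ₗ[ℂ] Matrix Y Y ℂ) :=
  {E | IsChannel E ∧ ∃ (S : Matrix X X ℂ →ₗ[ℂ] Matrix Y Y ℂ) (R : Matrix Y Y ℂ →ₗ[ℂ] Matrix X X ℂ),
    IsSubchannel S ∧ IsSubchannel R ∧ R ∘ₗ E ∘ₗ S = LinearMap.id}

/-- The map `A ↦ ∑ i, K i * A * (K i)ᴴ` with Kraus operators `K i`. -/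
def krausMap {ι X Y : Type*} [Fintype ι] [Fintype X] (K : ι → Matrix Y X ℂ) :
    Matrix X X ℂ →ₗ[ℂ] Matrix Y Y ℂ where
  toFun A := ∑ i, K i * A * (K i)ᴴ
  map_add' A B := by simp only [Matrix.mul_add, Matrix.add_mul, Finset.sum_add_distrib]
  map_smul' c A := by
    simp only [Matrix.mul_smul, Matrix.smul_mul, Finset.smul_sum, RingHom.id_apply]

/-- `Q ^ (-1/2)` for positive semidefinite `Q`, by the functional calculus. Since `(√0)⁻¹ = 0` here,
it is the Moore-Penrose inverse of the square root when `Q` is singular. -/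
def invSqrt {Y : Type*} [Fintype Y] [DecidableEq Y] (Q : Matrix Y Y ℂ) : Matrix Y Y ℂ :=
  cfc (fun t : ℝ => (√t)⁻¹) Q

/-- The map with Kraus operators `G i * Q ^ (-1/2)`, where `Q = ∑ i, (G i)ᴴ * G i`. -/
def normalizedKraus {ι Y : Type*} [Fintype ι] [Fintype Y] [DecidableEq Y]
    (G : ι → Matrix Y Y ℂ) : Matrix Y Y ℂ →ₗ[ℂ] Matrix Y Y ℂ :=
  krausMap fun i => G i * invSqrt (∑ j, (G j)ᴴ * G j)

/-- The standard complex normal distribution: the real and imaginary parts are independent centred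
real Gaussians of variance `1/2`. -/
def stdComplexNormal : Measure ℂ :=
  ((gaussianReal 0 (1 / 2)).prod (gaussianReal 0 (1 / 2))).map
    Complex.measurableEquivRealProd.symm

/-- A Ginibre matrix: independent entries, each with the standard complex normal distribution. -/
structure IsGinibre {Ω Y : Type*} [MeasurableSpace Ω] (G : Ω → Matrix Y Y ℂ) (P : Measure Ω) :
    Prop where
  hasLaw : ∀ a b, HasLaw (fun ω => G ω a b) stdComplexNormal P
  indep : iIndepFun (fun (q : Y × Y) ω => G ω q.1 q.2) P

end

/-! Write `K i = G i * Q ^ (-1/2)` for the Kraus operators, where `Q = ∑ i, (G i)ᴴ * G i`.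

*Probabilistic correction.* It suffices to find single operators `V` and `W` with `W * G i * V`
scalar for all `i` and not always zero: when `Q` is invertible, the encoding operator
`Q ^ (1/2) * V` undoes the normalization. The bound on `r` forces `dim X ≤ dim Y`, so `V` can be a
fixed coordinate inclusion. If the columns of the `G i * V` are linearly independent, they have a
common left inverse `W` (`exists_common_leftInverse`). If they span, the bound makes the linear
system `W * G i * V = c i • 1` in the unknowns `(W, c)` underdetermined, and `c = 0` would force
`W = 0` (`exists_common_compression`). Almost surely one of these occurs, since minors are
determinants of matrices with independent entries, that is, nonzero polynomials in independent
variables with diffuse laws (`ae_det_ne_zero_of_iIndepFun`).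

*Perfect correction.* By the Knill–Laflamme conditions (`exists_knillLaflamme`), perfect correction
gives a nonzero `V` for which all `(G i * V)ᴴ * (G j * V)` are scalar. This condition on `G` is
closed (`isClosed_hasScalarCompression`), while the joint law of the entries charges every nonempty
open set; so it is enough to exhibit a single `G` violating it when
`dim Y ≤ r ^ 2 * (dim X - 1)`. Split the coordinates of `Y` into `r ^ 2` blocks of size less than
`dim X`, and let `G i` be diagonal and constant on the blocks, in such a way that the products
`(G i)ᴴ * G j` span the block projections. A block projection has rank less than `dim X`, so its
compression by `V`, being scalar, is zero; summing over the blocks, `V = 0`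
(`exists_not_hasScalarCompression`). -/

/-! ### Kraus operators -/

open scoped Kronecker in
lemma tensorId_krausMap {ι X Y Z : Type*} [Fintype ι] [Fintype X] [Fintype Z] [DecidableEq Z]
    (K : ι → Matrix Y X ℂ) (Q : Matrix (X × Z) (X × Z) ℂ) :
    tensorId (krausMap K) Q =
      ∑ i, (K i ⊗ₖ (1 : Matrix Z Z ℂ)) * Q * (K i ⊗ₖ (1 : Matrix Z Z ℂ))ᴴ := by
  ext ⟨a, k⟩ ⟨b, l⟩
  simp [tensorId, krausMap, Matrix.mul_apply, Matrix.sum_apply, Fintype.sum_prod_type,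
    Matrix.one_apply, apply_ite star]

lemma isCompletelyPositive_krausMap {ι X Y : Type*} [Fintype ι] [Fintype X] [Finite Y]
    (K : ι → Matrix Y X ℂ) : IsCompletelyPositive (krausMap K) := by
  classical
  intro Q hQ
  rw [tensorId_krausMap]
  exact Matrix.posSemidef_sum _ fun i _ => hQ.mul_mul_conjTranspose_same _

lemma posSemidef_krausMap {ι X Y : Type*} [Fintype ι] [Fintype X] [Finite Y]
    (K : ι → Matrix Y X ℂ) {ρ : Matrix X X ℂ} (hρ : ρ.PosSemidef) :
    (krausMap K ρ).PosSemidef :=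
  Matrix.posSemidef_sum _ fun _ _ => hρ.mul_mul_conjTranspose_same _

lemma krausMap_single_apply {ι X Y : Type*} [Fintype ι] [Fintype X] [DecidableEq X]
    (K : ι → Matrix Y X ℂ) (x x' : X) (y y' : Y) :
    krausMap K (Matrix.single x x' 1) y y' = ∑ i, K i y x * star (K i y' x') := by
  simp [krausMap, Matrix.sum_apply, Matrix.mul_apply, Matrix.single_apply, ite_and]

open scoped MatrixOrder in
lemma Matrix.PosSemidef.exists_eq_conjTranspose_mul_self {n : Type*} [Fintype n]
    {A : Matrix n n ℂ} (hA : A.PosSemidef) : ∃ B : Matrix n n ℂ, A = Bᴴ * B := by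
  classical
  exact CStarAlgebra.nonneg_iff_eq_star_mul_self.mp hA.nonneg

/-- Every completely positive map has Kraus operators: the conjugated rows of a matrix `B` for which
`Bᴴ * B` is the Choi matrix. -/
lemma exists_eq_krausMap {X Y : Type*} [Fintype X] [Fintype Y]
    {Φ : Matrix X X ℂ →ₗ[ℂ] Matrix Y Y ℂ} (hΦ : IsCompletelyPositive Φ) :
    ∃ K : Y × X → Matrix Y X ℂ, Φ = krausMap K := by
  classical
  let w : X × X → ℂ := fun p => if p.1 = p.2 then 1 else 0
  obtain ⟨B, hB⟩ := 
    (hΦ _ (Matrix.posSemidef_vecMulVec_self_star w)).exists_eq_conjTranspose_mul_self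
  refine ⟨fun p => Matrix.of fun y i => star (B p (y, i)), ?_⟩
  refine Matrix.ext_linearMap _ fun i j => LinearMap.ext_ring ?_
  ext y y'
  have h := congrFun (congrFun hB (y, i)) (y', j)
  have hs : (Matrix.of fun a b => Matrix.vecMulVec w (star w) (a, i) (b, j)) =
      Matrix.single i j (1 : ℂ) := by
    ext a b
    simp [w, Matrix.vecMulVec_apply, Matrix.single_apply, ite_and, eq_comm]
    split_ifs <;> rfl
  simp only [tensorId, Matrix.of_apply, hs] at h
  simp only [LinearMap.comp_apply, Matrix.singleLinearMap_apply]
  rw [h, krausMap_single_apply]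
  simp [Matrix.mul_apply]

lemma trace_krausMap {ι X Y : Type*} [Fintype ι] [Fintype X] [Fintype Y]
    (K : ι → Matrix Y X ℂ) (A : Matrix X X ℂ) :
    (krausMap K A).trace = ((∑ i, (K i)ᴴ * K i) * A).trace := by
  simp only [krausMap, LinearMap.coe_mk, AddHom.coe_mk, Matrix.trace_sum, Matrix.sum_mul]
  exact Finset.sum_congr rfl fun i _ => (Matrix.trace_mul_cycle _ _ _).trans <| by
    rw [Matrix.mul_assoc]

lemma krausMap_comp {ι κ X Y Z : Type*} [Fintype ι] [Fintype κ] [Fintype X] [Fintype Y]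
    (L : κ → Matrix Z Y ℂ) (K : ι → Matrix Y X ℂ) :
    krausMap L ∘ₗ krausMap K = krausMap fun p : κ × ι => L p.1 * K p.2 := by
  ext A : 1
  simp [krausMap, Fintype.sum_prod_type, Matrix.mul_sum, Matrix.sum_mul, Matrix.mul_assoc]

/-- Scaling to a density operator extends the trace condition to all positive operators. -/
lemma IsSubchannel.trace_le {X Y : Type*} [Fintype X] [Fintype Y]
    {Φ : Matrix X X ℂ →ₗ[ℂ] Matrix Y Y ℂ} (hΦ : IsSubchannel Φ) {ρ : Matrix X X ℂ}
    (hρ : ρ.PosSemidef) : (Φ ρ).trace ≤ ρ.trace := by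
  obtain ⟨K, rfl⟩ := exists_eq_krausMap hΦ.1
  rcases eq_or_ne ρ.trace 0 with h0 | h0
  · rw [hρ.trace_eq_zero_iff.mp h0]
    simp
  have ht := hρ.trace_nonneg
  have ht' := (posSemidef_krausMap K hρ).trace_nonneg
  rw [Complex.nonneg_iff] at ht ht'
  have him : ρ.trace = (ρ.trace.re : ℂ) := Complex.ext rfl ht.2.symm
  have hpos : 0 < ρ.trace.re := by
    refine lt_of_le_of_ne ht.1 fun h => h0 ?_
    rw [him, ← h, Complex.ofReal_zero]
  have hd : IsDensity ((ρ.trace.re⁻¹ : ℂ) • ρ) := by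
    refine ⟨hρ.smul ?_, ?_⟩
    · rw [← Complex.ofReal_inv]
      exact Complex.zero_le_real.mpr (inv_nonneg.mpr ht.1)
    · rw [Matrix.trace_smul, smul_eq_mul, ← him, inv_mul_cancel₀ h0]
  have h := hΦ.2 _ hd
  rw [map_smul, Matrix.trace_smul, smul_eq_mul, ← Complex.ofReal_inv, Complex.re_ofReal_mul,
    inv_mul_le_iff₀ hpos, mul_one] at h
  exact ⟨h, ht'.2.symm.trans ht.2⟩

lemma IsChannel.isSubchannel {X Y : Type*} [Fintype X] [Fintype Y]
    {Φ : Matrix X X ℂ →ₗ[ℂ] Matrix Y Y ℂ} (hΦ : IsChannel Φ) : IsSubchannel Φ :=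
  ⟨hΦ.1, fun ρ hρ => by rw [hΦ.2 ρ hρ]; simp⟩

lemma posSemidef_one_sub_of_isSubchannel {ι X Y : Type*} [Fintype ι] [Fintype X] [Fintype Y]
    [DecidableEq X] {K : ι → Matrix Y X ℂ} (h : IsSubchannel (krausMap K)) :
    (1 - ∑ i, (K i)ᴴ * K i).PosSemidef := by
  refine .of_dotProduct_mulVec_nonneg ?_ fun x => ?_
  · exact Matrix.isHermitian_one.sub
      (Matrix.posSemidef_sum _ fun i _ => Matrix.posSemidef_conjTranspose_mul_self (K i)).1
  · have h1 := h.trace_le (Matrix.posSemidef_vecMulVec_self_star x)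
    rw [trace_krausMap, ← sub_nonneg, ← Matrix.trace_sub] at h1
    have : Matrix.vecMulVec x (star x) - (∑ i, (K i)ᴴ * K i) * Matrix.vecMulVec x (star x) =
        (1 - ∑ i, (K i)ᴴ * K i) * Matrix.vecMulVec x (star x) := by
      rw [Matrix.sub_mul, Matrix.one_mul]
    rwa [this, Matrix.mul_vecMulVec, Matrix.trace_vecMulVec, dotProduct_comm] at h1

/-! ### Knill–Laflamme conditions -/

/-- Kraus operators of the identity map are scalars: the equation on matrix units says that the
vectors `(T t a x)ₜ` vanish for `a ≠ x` and coincide for `a = x`. -/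
lemma exists_smul_one_of_krausMap_eq_id {τ X : Type*} [Fintype τ] [Fintype X] [DecidableEq X]
    [Nonempty X] {T : τ → Matrix X X ℂ} (h : krausMap T = LinearMap.id) (t : τ) :
    ∃ c : ℂ, T t = c • (1 : Matrix X X ℂ) := by
  have hT (a b x y : X) : ∑ t, T t a x * star (T t b y) =
      if x = a ∧ y = b then 1 else 0 := by
    rw [← krausMap_single_apply, h, LinearMap.id_apply, Matrix.single_apply]
  have hsq (f : τ → ℂ) (hf : ∑ t, f t * star (f t) = 0) : f t = 0 := by
    have := (Finset.sum_eq_zero_iff_of_nonneg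
      (fun t _ => mul_star_self_nonneg (f t))).mp hf t (Finset.mem_univ t)
    simpa using this
  obtain ⟨x₀⟩ := ‹Nonempty X›
  refine ⟨T t x₀ x₀, ?_⟩
  ext a x
  rcases eq_or_ne a x with rfl | hax
  · have := hsq (fun t => T t a a - T t x₀ x₀) (by
      simp only [star_sub, sub_mul, mul_sub, Finset.sum_sub_distrib, hT]
      simp)
    simpa using sub_eq_zero.mp this
  · simpa [hax] using hsq (fun t => T t a x) (by rw [hT]; simp [hax.symm])

/-- The necessity half of the Knill–Laflamme conditions, for one Kraus operator of the encoding.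
Since decoding loses no trace, `∑ Bᴴ B` acts as the identity on the range of every `K i * V`, and
the operators `B * K i * V` are scalars. -/
theorem exists_knillLaflamme {ι X Y : Type*} [Fintype ι] [Fintype X] [Fintype Y] [Nonempty X]
    [DecidableEq X]
    {K : ι → Matrix Y Y ℂ} (hE : IsChannel (krausMap K))
    {S : Matrix X X ℂ →ₗ[ℂ] Matrix Y Y ℂ} {R : Matrix Y Y ℂ →ₗ[ℂ] Matrix X X ℂ}
    (hS : IsSubchannel S) (hR : IsSubchannel R) (h : R ∘ₗ krausMap K ∘ₗ S = LinearMap.id) :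
    ∃ V : Matrix Y X ℂ, (∃ i, K i * V ≠ 0) ∧
      ∀ i j, ∃ c : ℂ, (K i * V)ᴴ * (K j * V) = c • (1 : Matrix X X ℂ) := by
  classical
  have htr : ((krausMap K) (S 1)).trace ≤ (R (krausMap K (S 1))).trace := by
    have h1 : R (krausMap K (S 1)) = 1 := LinearMap.congr_fun h 1
    rw [h1]
    have hS1 : (S 1).PosSemidef := by
      obtain ⟨A, rfl⟩ := exists_eq_krausMap hS.1
      exact posSemidef_krausMap A .one
    exact (hE.isSubchannel.trace_le hS1).trans (hS.trace_le .one)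
  obtain ⟨A, rfl⟩ := exists_eq_krausMap hS.1
  obtain ⟨B, rfl⟩ := exists_eq_krausMap hR.1
  set M : Matrix Y Y ℂ := 1 - ∑ b, (B b)ᴴ * B b with hMdef
  have hM : M.PosSemidef := posSemidef_one_sub_of_isSubchannel hR
  -- the part `M` of the identity missed by the decoder vanishes on the output of the encoder
  have hMK (i : ι) (a : Y × X) : M * (K i * A a) = 0 := by
    have hp (p : ι × (Y × X)) : ((K p.1 * A p.2)ᴴ * M * (K p.1 * A p.2)).PosSemidef :=
      hM.conjTranspose_mul_mul_same _
    have hsum : ∑ p : ι × (Y × X), ((K p.1 * A p.2)ᴴ * M * (K p.1 * A p.2)).trace ≤ 0 := by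
      have hKA : krausMap K (krausMap A 1) =
          ∑ p : ι × (Y × X), (K p.1 * A p.2) * (K p.1 * A p.2)ᴴ := by
        rw [← LinearMap.comp_apply, krausMap_comp]
        simp [krausMap]
      have : ∑ p : ι × (Y × X), ((K p.1 * A p.2)ᴴ * M * (K p.1 * A p.2)).trace =
          (M * krausMap K (krausMap A 1)).trace := by
        rw [hKA, Finset.mul_sum, Matrix.trace_sum]
        refine Finset.sum_congr rfl fun p _ => ?_
        rw [Matrix.trace_mul_cycle, Matrix.trace_mul_comm]
      rw [this, hMdef, Matrix.sub_mul, Matrix.one_mul, Matrix.trace_sub, ← trace_krausMap]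
      exact sub_nonpos.mpr htr
    have h0 := (Finset.sum_eq_zero_iff_of_nonneg fun p _ => (hp p).trace_nonneg).mp
      (le_antisymm hsum (Finset.sum_nonneg fun p _ => (hp p).trace_nonneg)) (i, a)
      (Finset.mem_univ _)
    rw [(hp _).trace_eq_zero_iff] at h0
    obtain ⟨N, hN⟩ := hM.exists_eq_conjTranspose_mul_self
    have hNK : N * (K i * A a) = 0 := by
      rw [← Matrix.conjTranspose_mul_self_eq_zero, ← h0, hN, Matrix.conjTranspose_mul]
      simp only [Matrix.mul_assoc]
    rw [hN, Matrix.mul_assoc, hNK, Matrix.mul_zero]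
  rw [krausMap_comp, krausMap_comp] at h
  have hT := exists_smul_one_of_krausMap_eq_id h
  choose c hc using hT
  have hne : ∃ (a : Y × X) (i : ι), K i * A a ≠ 0 := by
    by_contra! hzero
    have h1 : krausMap (fun p : (X × Y) × ι × (Y × X) => B p.1 * (K p.2.1 * A p.2.2)) 1 =
        (1 : Matrix X X ℂ) := LinearMap.congr_fun h 1
    simp [krausMap, hzero] at h1
  obtain ⟨a, hi⟩ := hne
  refine ⟨A a, hi, fun i j => ⟨∑ b, star (c (b, i, a)) * c (b, j, a), ?_⟩⟩
  have h1 : K j * A a = (∑ b, (B b)ᴴ * B b) * (K j * A a) := by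
    have := hMK j a
    rwa [hMdef, Matrix.sub_mul, Matrix.one_mul, sub_eq_zero] at this
  rw [h1, Matrix.sum_mul, Matrix.mul_sum, Finset.sum_smul]
  refine Finset.sum_congr rfl fun b _ => ?_
  calc (K i * A a)ᴴ * ((B b)ᴴ * B b * (K j * A a))
      = (B b * (K i * A a))ᴴ * (B b * (K j * A a)) := by
        rw [Matrix.conjTranspose_mul (B b)]; simp only [Matrix.mul_assoc]
    _ = _ := by
        rw [hc (b, i, a), hc (b, j, a)]
        simp [smul_smul, mul_comm]

/-! ### Genericity of independent entries -/

/-- The zero set of a nonzero polynomial is null for a product of diffuse laws, by induction on the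
number of variables. -/
lemma ae_eval_mvPolynomial_ne_zero (μ : Measure ℂ) [IsProbabilityMeasure μ]
    [NullSingletonClass μ] {n : ℕ} {p : MvPolynomial (Fin n) ℂ} (hp : p ≠ 0) :
    ∀ᵐ z ∂Measure.pi (fun _ : Fin n => μ), MvPolynomial.eval z p ≠ 0 := by
  induction n with
  | zero =>
    rw [MvPolynomial.eq_C_of_isEmpty p] at hp ⊢
    refine .of_forall fun z => ?_
    rw [MvPolynomial.eval_C]
    exact fun h => hp (by rw [h, map_zero])
  | succ n ih =>
    have hm := (measurePreserving_piFinSuccAbove (fun _ : Fin (n + 1) => μ) 0).symm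
    have hmeas : MeasurableSet {z : Fin (n + 1) → ℂ | MvPolynomial.eval z p ≠ 0} :=
      ((MvPolynomial.continuous_eval p).measurable (measurableSet_singleton 0)).compl
    rw [← hm.map_eq, ae_map_iff hm.measurable.aemeasurable hmeas,
      Measure.ae_prod_iff_ae_ae (by exact hm.measurable hmeas),
      Measure.ae_ae_comm (by exact hm.measurable hmeas)]
    have hq : MvPolynomial.finSuccEquiv ℂ n p ≠ 0 := by simpa using hp
    -- for almost every value of the last variables the leading coefficient does not vanish
    filter_upwards [ih (Polynomial.leadingCoeff_ne_zero.mpr hq)] with s hs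
    have hmap : (MvPolynomial.finSuccEquiv ℂ n p).map (MvPolynomial.eval s) ≠ 0 := by
      intro h
      apply hs
      have := congrArg (fun q => q.coeff (MvPolynomial.finSuccEquiv ℂ n p).natDegree) h
      simpa [Polynomial.coeff_map] using this
    have hroots : ∀ᵐ y ∂μ, y ∉ ((MvPolynomial.finSuccEquiv ℂ n p).map
        (MvPolynomial.eval s)).roots.toFinset :=
      measure_eq_zero_iff_ae_notMem.mp ((Finset.countable_toSet _).measure_zero _)
    filter_upwards [hroots] with y hy
    have hcons : (MeasurableEquiv.piFinSuccAbove (fun _ : Fin (n + 1) => ℂ) 0).symm (y, s) =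
        Fin.cons y s := by
      simp [MeasurableEquiv.piFinSuccAbove, Fin.insertNthEquiv]
    rw [hcons, MvPolynomial.eval_eq_eval_mv_eval']
    simpa [Polynomial.mem_roots hmap] using hy

/-- A square matrix with independent entries of a common diffuse law is almost surely invertible:
the determinant is a nonzero polynomial in the entries. -/
lemma ae_det_ne_zero_of_iIndepFun {n Ω : Type*} [Fintype n] [DecidableEq n] [MeasurableSpace Ω]
    {P : Measure Ω} {μ : Measure ℂ} [IsProbabilityMeasure μ] [NullSingletonClass μ]
    {Z : n × n → Ω → ℂ} (hZ : iIndepFun Z P) (hlaw : ∀ q, HasLaw (Z q) μ P) :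
    ∀ᵐ ω ∂P, (Matrix.of fun a b => Z (a, b) ω).det ≠ 0 := by
  let e := Fintype.equivFin (n × n)
  have hlaw' : HasLaw (fun ω i => Z (e.symm i) ω) (Measure.pi fun _ => μ) P :=
    iIndepFun.hasLaw_pi (fun i => hlaw (e.symm i)) (hZ.precomp e.symm.injective)
  have hp : MvPolynomial.rename e (Matrix.mvPolynomialX n n ℂ).det ≠ 0 :=
    (MvPolynomial.rename_injective e e.injective).ne_iff' (map_zero _) |>.mpr
      (Matrix.det_mvPolynomialX_ne_zero n ℂ)
  have h := ae_eval_mvPolynomial_ne_zero μ hp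
  rw [← hlaw'.map_eq] at h
  filter_upwards [ae_of_ae_map hlaw'.aemeasurable h] with ω hω
  rw [MvPolynomial.eval_rename, RingHom.map_det] at hω
  convert hω using 3
  ext a b
  simp [Matrix.mvPolynomialX_apply, e]

/-! ### The joint law of Ginibre matrices -/

instance : IsProbabilityMeasure stdComplexNormal := by
  unfold stdComplexNormal
  exact Measure.isProbabilityMeasure_map (MeasurableEquiv.measurable _).aemeasurable

instance : NullSingletonClass stdComplexNormal := by
  have : NullSingletonClass (gaussianReal 0 (1 / 2)) :=
    nullSingletonClass_gaussianReal (by norm_num)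
  refine ⟨fun x => ?_⟩
  rw [stdComplexNormal, MeasurableEquiv.map_apply]
  have : Complex.measurableEquivRealProd.symm ⁻¹' {x} = {Complex.measurableEquivRealProd x} := by
    ext y
    simp [Complex.ext_iff, Prod.ext_iff]
  rw [this]
  exact measure_singleton _

instance : stdComplexNormal.IsOpenPosMeasure := by
  have : (gaussianReal 0 (1 / 2)).IsOpenPosMeasure :=
    (gaussianReal_absolutelyContinuous' 0 (by norm_num)).isOpenPosMeasure
  exact Complex.equivRealProdCLM.symm.continuous.isOpenPosMeasure_map
    Complex.equivRealProdCLM.symm.surjective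

/-- The joint law of the entries of independent Ginibre matrices indexed by `ι`; the point `z` stands
for the matrices with entries `z i (a, b)`. -/
noncomputable def ginibreLaw (ι Y : Type*) [Fintype ι] [Fintype Y] : Measure (ι → Y × Y → ℂ) :=
  Measure.pi fun _ => Measure.pi fun _ => stdComplexNormal

instance (ι Y : Type*) [Fintype ι] [Fintype Y] : (ginibreLaw ι Y).IsOpenPosMeasure := by
  unfold ginibreLaw
  infer_instance

lemma hasLaw_ginibreLaw {ι Y Ω : Type*} [Fintype ι] [Fintype Y] [MeasurableSpace Ω]
    {P : Measure Ω} {G : ι → Ω → Matrix Y Y ℂ} (hG : ∀ i, IsGinibre (G i) P)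
    (hindep : iIndepFun (fun i ω (q : Y × Y) => G i ω q.1 q.2) P) :
    HasLaw (fun ω i (q : Y × Y) => G i ω q.1 q.2) (ginibreLaw ι Y) P :=
  iIndepFun.hasLaw_pi
    (fun i => iIndepFun.hasLaw_pi (fun q => (hG i).hasLaw q.1 q.2) (hG i).indep) hindep

lemma ae_ginibreLaw_det_ne_zero {ι Y n : Type*} [Fintype ι] [Fintype Y] [Fintype n]
    [DecidableEq n] {f : n → n → ι × (Y × Y)} (hf : Function.Injective (Function.uncurry f)) :
    ∀ᵐ z ∂ginibreLaw ι Y, (Matrix.of fun a b => z (f a b).1 (f a b).2).det ≠ 0 := by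
  have hind : iIndepFun (fun (q : ι × (Y × Y)) (z : ι → Y × Y → ℂ) => z q.1 q.2)
      (ginibreLaw ι Y) := by
    unfold ginibreLaw
    have := iIndepFun_uncurry_infinitePi' (X := fun (_ : ι) (_ : Y × Y) (x : ℂ) => x)
      (fun _ _ => stdComplexNormal) (fun _ _ => measurable_id)
    simpa only [Measure.infinitePi_eq_pi] using this
  refine ae_det_ne_zero_of_iIndepFun (μ := stdComplexNormal) (hind.precomp hf) fun q => ?_
  unfold ginibreLaw
  exact ((measurePreserving_eval (fun _ : Y × Y => stdComplexNormal) _).comp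
    (measurePreserving_eval (fun _ : ι => Measure.pi fun _ : Y × Y => stdComplexNormal) _)).hasLaw

/-! ### Probabilistic correction -/

section FrobeniusNorm

open scoped Matrix.Norms.Frobenius

lemma re_trace_mul_conjTranspose_self {m n : Type*} [Fintype m] [Fintype n] (A : Matrix m n ℂ) :
    (A * Aᴴ).trace.re = ‖A‖ ^ 2 := by
  rw [Matrix.frobenius_norm_def, ← Real.sqrt_eq_rpow, Real.sq_sqrt (by positivity)]
  simp [Matrix.trace, Matrix.mul_apply, RCLike.mul_conj, ← Complex.ofReal_pow]

lemma exists_smul_isSubchannel {X Y : Type*} [Fintype X] [Fintype Y] (V : Matrix Y X ℂ) :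
    ∃ s : ℂ, s ≠ 0 ∧ IsSubchannel (krausMap fun _ : Unit => s • V) := by
  have hpos : 0 < ‖V‖ + 1 := by positivity
  have hs : ((‖V‖ + 1 : ℝ) : ℂ)⁻¹ ≠ 0 := inv_ne_zero (Complex.ofReal_ne_zero.mpr hpos.ne')
  refine ⟨_, hs, isCompletelyPositive_krausMap _, fun ρ hρ => ?_⟩
  set W := ((‖V‖ + 1 : ℝ) : ℂ)⁻¹ • V with hW
  have hWnorm : ‖W‖ ≤ 1 := by
    rw [hW, norm_smul, norm_inv, Complex.norm_real, Real.norm_of_nonneg hpos.le,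
      inv_mul_le_iff₀ hpos]
    linarith
  obtain ⟨B, rfl⟩ := hρ.1.exists_eq_conjTranspose_mul_self
  have hB : ‖Bᴴ‖ ^ 2 = 1 := by
    rw [← re_trace_mul_conjTranspose_self, Matrix.conjTranspose_conjTranspose, hρ.2, Complex.one_re]
  have hWB : krausMap (fun _ : Unit => W) (Bᴴ * B) = (W * Bᴴ) * (W * Bᴴ)ᴴ := by
    simp [krausMap, Matrix.mul_assoc]
  rw [hWB, re_trace_mul_conjTranspose_self]
  calc ‖W * Bᴴ‖ ^ 2 ≤ (‖W‖ * ‖Bᴴ‖) ^ 2 := by gcongr; exact Matrix.frobenius_norm_mul _ _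
    _ = ‖W‖ ^ 2 := by rw [mul_pow, hB, mul_one]
    _ ≤ 1 := pow_le_one₀ (norm_nonneg _) hWnorm

end FrobeniusNorm

lemma isHermitian_invSqrt {Y : Type*} [Fintype Y] [DecidableEq Y] (Q : Matrix Y Y ℂ) :
    (invSqrt Q)ᴴ = invSqrt Q :=
  cfc_predicate (p := IsSelfAdjoint) (fun t : ℝ => (√t)⁻¹) Q

open scoped MatrixOrder in
lemma invSqrt_mul_mul_invSqrt {Y : Type*} [Fintype Y] [DecidableEq Y] {Q : Matrix Y Y ℂ}
    (hQ : Q.PosDef) : invSqrt Q * (Q * invSqrt Q) = 1 := by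
  have hsa : IsSelfAdjoint Q := hQ.1
  have hpos : ∀ t ∈ spectrum ℝ Q, 0 < t := by
    intro t ht
    refine lt_of_le_of_ne (spectrum_nonneg_of_nonneg hQ.posSemidef.nonneg ht) ?_
    rintro rfl
    exact spectrum.zero_notMem ℝ hQ.isUnit ht
  have hcont : ContinuousOn (fun t : ℝ => (√t)⁻¹) (spectrum ℝ Q) :=
    Real.continuous_sqrt.continuousOn.inv₀ fun t ht => (Real.sqrt_pos.mpr (hpos t ht)).ne'
  have hQid : cfc (fun t : ℝ => t) Q = Q := cfc_id' ℝ Q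
  unfold invSqrt
  nth_rw 2 [← hQid]
  rw [← cfc_mul _ _ Q, ← cfc_mul _ _ Q, ← cfc_one ℝ Q]
  refine cfc_congr fun t ht => ?_
  have h := Real.sqrt_pos.mpr (hpos t ht)
  simp only [Pi.one_apply]
  nth_rw 2 [← Real.mul_self_sqrt (hpos t ht).le]
  field_simp

lemma isChannel_normalizedKraus {ι Y : Type*} [Fintype ι] [Fintype Y] [DecidableEq Y]
    {G : ι → Matrix Y Y ℂ} (hQ : (∑ i, (G i)ᴴ * G i).PosDef) : IsChannel (normalizedKraus G) := by
  refine ⟨isCompletelyPositive_krausMap _, fun ρ hρ => ?_⟩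
  have : ∑ i, (G i * invSqrt (∑ j, (G j)ᴴ * G j))ᴴ * (G i * invSqrt (∑ j, (G j)ᴴ * G j)) = 1 := by
    rw [← invSqrt_mul_mul_invSqrt hQ, Matrix.sum_mul, Matrix.mul_sum]
    refine Finset.sum_congr rfl fun i _ => ?_
    rw [Matrix.conjTranspose_mul, isHermitian_invSqrt]
    simp only [Matrix.mul_assoc]
  rw [normalizedKraus, trace_krausMap, this, Matrix.one_mul, hρ.2]

lemma krausMap_smul_one {τ X : Type*} [Fintype τ] [Fintype X] [DecidableEq X] (c : τ → ℂ) :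
    krausMap (fun t => c t • (1 : Matrix X X ℂ)) = (∑ t, c t * star (c t)) • LinearMap.id := by
  ext A : 1
  simp [krausMap, Finset.sum_smul, smul_smul, mul_comm]

/-- A single pair of operators `V`, `W` compressing every `G i` to a scalar gives an encoding and a
decoding of the normalized map; the encoding undoes the normalization. -/
lemma normalizedKraus_mem_probCorrectable {ι X Y : Type*} [Fintype ι] [Fintype X] [Fintype Y]
    [DecidableEq X] [DecidableEq Y] [Nonempty X] {G : ι → Matrix Y Y ℂ}
    (hQ : (∑ i, (G i)ᴴ * G i).PosDef) {V : Matrix Y X ℂ} {W : Matrix X Y ℂ} {c : ι → ℂ}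
    (h : ∀ i, W * (G i * V) = c i • (1 : Matrix X X ℂ)) (hc : ∃ i, c i ≠ 0) :
    normalizedKraus G ∈ probCorrectable X Y := by
  refine ⟨isChannel_normalizedKraus hQ, ?_⟩
  set Q := ∑ i, (G i)ᴴ * G i with hQdef
  obtain ⟨s, hs, hS⟩ := exists_smul_isSubchannel (Q * invSqrt Q * V)
  obtain ⟨t, ht, hR⟩ := exists_smul_isSubchannel W
  have hcomp : krausMap (fun _ : Unit => t • W) ∘ₗ normalizedKraus G ∘ₗ
      krausMap (fun _ : Unit => s • (Q * invSqrt Q * V)) =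
      (∑ p : Unit × ι × Unit, (t * s * c p.2.1) * star (t * s * c p.2.1)) • LinearMap.id := by
    rw [normalizedKraus, krausMap_comp, krausMap_comp, ← krausMap_smul_one]
    congr 1
    ext p : 1
    have hV : G p.2.1 * invSqrt Q * (Q * invSqrt Q * V) = G p.2.1 * V := by
      rw [Matrix.mul_assoc (G p.2.1), ← Matrix.mul_assoc (invSqrt Q), invSqrt_mul_mul_invSqrt hQ,
        Matrix.one_mul]
    rw [← hQdef, Matrix.mul_smul, hV, Matrix.smul_mul, Matrix.mul_smul, h, smul_smul, smul_smul,
      mul_assoc]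
  refine ⟨_, _, hS, hR, ?_, _, hcomp⟩
  rw [hcomp]
  refine smul_ne_zero (fun h0 => ?_) fun h0 => one_ne_zero (LinearMap.congr_fun h0 1)
  obtain ⟨i, hi⟩ := hc
  have := (Finset.sum_eq_zero_iff_of_nonneg fun p _ => mul_star_self_nonneg _).mp h0
    ((), i, ()) (Finset.mem_univ _)
  simp [hs, ht, hi] at this

lemma mul_one_submatrix_apply {X Y : Type*} [Fintype Y] [DecidableEq Y] (A : Matrix Y Y ℂ)
    (e : X → Y) : A * (1 : Matrix Y Y ℂ).submatrix id e = A.submatrix id e := by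
  ext y x
  simp [Matrix.mul_apply, Matrix.one_apply]

/-- If the chosen columns of all `G i` are linearly independent, as witnessed by the minor on the
rows `j`, then they have a common left inverse. -/
lemma exists_common_leftInverse {ι X Y : Type*} [Fintype ι] [Fintype X] [Fintype Y]
    [DecidableEq ι] [DecidableEq X] [DecidableEq Y] (G : ι → Matrix Y Y ℂ) (e : X → Y)
    (j : ι × X → Y) (hdet : (Matrix.of fun p q : ι × X => G q.1 (j p) (e q.2)).det ≠ 0) :
    ∃ W : Matrix X Y ℂ, ∀ i, W * (G i * (1 : Matrix Y Y ℂ).submatrix id e) = 1 := by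
  set M := Matrix.of fun p q : ι × X => G q.1 (j p) (e q.2) with hM
  have hinv : M⁻¹ * M = 1 := Matrix.nonsing_inv_mul _ hdet.isUnit
  let N : Matrix X (ι × X) ℂ := Matrix.of fun x p => ∑ k, M⁻¹ (k, x) p
  refine ⟨N * (1 : Matrix Y Y ℂ).submatrix j id, fun i => ?_⟩
  have hsub : (1 : Matrix Y Y ℂ).submatrix j id * (G i).submatrix id e = (G i).submatrix j e := by
    ext p x
    simp [Matrix.mul_apply, Matrix.one_apply]
  rw [mul_one_submatrix_apply, Matrix.mul_assoc, hsub]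
  ext x x'
  calc (N * (G i).submatrix j e) x x' = ∑ p, (∑ k, M⁻¹ (k, x) p) * M p (i, x') := by
        simp [Matrix.mul_apply, N, hM]
    _ = ∑ k, (M⁻¹ * M) (k, x) (i, x') := by
        simp only [Finset.sum_mul, Matrix.mul_apply]
        exact Finset.sum_comm
    _ = (1 : Matrix X X ℂ) x x' := by
        simp [hinv, Matrix.one_apply, Prod.ext_iff, ite_and]

/-- If the chosen columns of all `G i` span, as witnessed by the minor on the columns `k`, then a
count of dimensions gives a `W` with `W * G i * V` scalar for all `i`, not all zero. -/
lemma exists_common_compression {ι X Y : Type*} [Fintype ι] [Fintype X] [Fintype Y]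
    [DecidableEq X] [DecidableEq Y] (G : ι → Matrix Y Y ℂ) (e : X → Y) (k : Y → ι × X)
    (hdet : (Matrix.of fun y y' => G (k y').1 y (e (k y').2)).det ≠ 0)
    (hcard : Fintype.card ι * (Fintype.card X * Fintype.card X) <
      Fintype.card ι + Fintype.card X * Fintype.card Y) :
    ∃ (W : Matrix X Y ℂ) (c : ι → ℂ),
      (∀ i, W * (G i * (1 : Matrix Y Y ℂ).submatrix id e) = c i • (1 : Matrix X X ℂ)) ∧
      ∃ i, c i ≠ 0 := by
  let T : ((ι → ℂ) × Matrix X Y ℂ) →ₗ[ℂ] (ι → Matrix X X ℂ) :=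
    { toFun := fun q i => q.2 * (G i * (1 : Matrix Y Y ℂ).submatrix id e) - q.1 i • 1
      map_add' := fun q q' => by
        ext1 i
        simp only [Prod.snd_add, Prod.fst_add, Pi.add_apply, Matrix.add_mul, add_smul]
        abel
      map_smul' := fun a q => by
        ext1 i
        simp [smul_sub, smul_smul] }
  have hker : LinearMap.ker T ≠ ⊥ := by
    apply LinearMap.ker_ne_bot_of_finrank_lt
    simpa [Module.finrank_matrix, Module.finrank_pi_fintype] using hcard
  obtain ⟨⟨c, W⟩, hmem, hne⟩ := Submodule.exists_mem_ne_zero_of_ne_bot hker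
  have hW (i : ι) : W * (G i * (1 : Matrix Y Y ℂ).submatrix id e) = c i • (1 : Matrix X X ℂ) :=
    sub_eq_zero.mp (congrFun (LinearMap.mem_ker.mp hmem) i)
  refine ⟨W, c, hW, ?_⟩
  by_contra! hc
  refine hne (Prod.ext (funext hc) ?_)
  have hWM : W * Matrix.of (fun y y' => G (k y').1 y (e (k y').2)) = 0 := by
    ext x y'
    have h := congrFun (congrFun (hW (k y').1) x) (k y').2
    rw [mul_one_submatrix_apply, hc, zero_smul] at h
    simpa [Matrix.mul_apply] using h
  calc W = W * (Matrix.of fun y y' => G (k y').1 y (e (k y').2)) *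
        (Matrix.of fun y y' => G (k y').1 y (e (k y').2))⁻¹ := by
        rw [Matrix.mul_assoc, Matrix.mul_nonsing_inv _ hdet.isUnit, Matrix.mul_one]
    _ = 0 := by rw [hWM, Matrix.zero_mul]

lemma ae_mem_probCorrectable {ι X Y : Type*} [Fintype ι] [Nonempty ι] [Fintype X] [Fintype Y]
    [DecidableEq Y] [Nonempty X] (hXY : Fintype.card X ≤ Fintype.card Y)
    (hcard : Fintype.card ι * (Fintype.card X * Fintype.card X) <
      Fintype.card ι + Fintype.card X * Fintype.card Y) :
    ∀ᵐ z ∂ginibreLaw ι Y,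
      normalizedKraus (fun i => Matrix.of fun a b => z i (a, b)) ∈ probCorrectable X Y := by
  classical
  obtain ⟨e⟩ := Function.Embedding.nonempty_of_card_le hXY
  obtain ⟨i₀⟩ := ‹Nonempty ι›
  have hinv : ∀ᵐ z ∂ginibreLaw ι Y,
      (∑ i, (Matrix.of fun a b => z i (a, b))ᴴ * Matrix.of fun a b => z i (a, b)).PosDef := by
    filter_upwards [ae_ginibreLaw_det_ne_zero (f := fun a b : Y => (i₀, (a, b)))
      (fun p q h => by simpa [Function.uncurry, Prod.ext_iff] using h)] with z hz
    rw [← Finset.add_sum_erase _ _ (Finset.mem_univ i₀)]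
    refine Matrix.PosDef.add_posSemidef ?_
      (Matrix.posSemidef_sum _ fun i _ => Matrix.posSemidef_conjTranspose_mul_self _)
    exact Matrix.PosDef.conjTranspose_mul_self _
      (Matrix.mulVec_injective_iff_isUnit.mpr ((Matrix.isUnit_iff_isUnit_det _).mpr hz.isUnit))
  -- the columns of `G i * V` are indexed by `ι × X` and live in dimension `card Y`
  rcases le_total (Fintype.card (ι × X)) (Fintype.card Y) with hle | hle
  · obtain ⟨j⟩ := Function.Embedding.nonempty_of_card_le hle
    filter_upwards [hinv, ae_ginibreLaw_det_ne_zero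
      (f := fun p q : ι × X => (q.1, (j p, e q.2))) (fun p q h => by
        simp only [Function.uncurry, Prod.mk.injEq, EmbeddingLike.apply_eq_iff_eq] at h
        exact Prod.ext h.2.1 (Prod.ext h.1 h.2.2))] with z hQ hz
    obtain ⟨W, hW⟩ := exists_common_leftInverse
      (fun i => Matrix.of fun a b => z i (a, b)) e j hz
    exact normalizedKraus_mem_probCorrectable (c := fun _ => 1) hQ
      (fun i => by rw [hW, one_smul]) ⟨i₀, one_ne_zero⟩
  · obtain ⟨k⟩ := Function.Embedding.nonempty_of_card_le hle
    filter_upwards [hinv, ae_ginibreLaw_det_ne_zero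
      (f := fun y y' : Y => ((k y').1, (y, e (k y').2))) (fun p q h => by
        simp only [Function.uncurry, Prod.mk.injEq, EmbeddingLike.apply_eq_iff_eq] at h
        exact Prod.ext h.2.1 (k.injective (Prod.ext h.1 h.2.2)))] with z hQ hz
    obtain ⟨W, c, hW, hc⟩ := exists_common_compression
      (fun i => Matrix.of fun a b => z i (a, b)) e k hz hcard
    exact normalizedKraus_mem_probCorrectable hQ hW hc

/-! ### Perfect correction -/

/-- The Knill–Laflamme conditions for the unnormalized operators `G i`: some nonzero `V` compresses
every product `(G i)ᴴ * G j` to a scalar. -/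
def HasScalarCompression {ι Y : Type*} [Fintype Y] (X : Type*) [DecidableEq X]
    (G : ι → Matrix Y Y ℂ) : Prop :=
  ∃ V : Matrix Y X ℂ, V ≠ 0 ∧ ∀ i j, ∃ c : ℂ, (G i * V)ᴴ * (G j * V) = c • (1 : Matrix X X ℂ)

lemma hasScalarCompression_of_mem_perfCorrectable {ι X Y : Type*} [Fintype ι] [Fintype X]
    [Fintype Y] [DecidableEq X] [DecidableEq Y] [Nonempty X] {G : ι → Matrix Y Y ℂ}
    (h : normalizedKraus G ∈ perfCorrectable X Y) : HasScalarCompression X G := by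
  obtain ⟨hE, S, R, hS, hR, hRES⟩ := h
  obtain ⟨V, ⟨i, hi⟩, hV⟩ := exists_knillLaflamme hE hS hR hRES
  simp only [Matrix.mul_assoc (G _)] at hi hV
  exact ⟨_, fun h0 => hi (by rw [h0, Matrix.mul_zero]), hV⟩

/-- The condition is closed, since `V` may be taken from a compact sphere. -/
lemma isClosed_hasScalarCompression (ι X Y : Type*) [Fintype X] [Fintype Y] [DecidableEq X] :
    IsClosed {z : ι → Y × Y → ℂ |
      HasScalarCompression X fun i => Matrix.of fun a b => z i (a, b)} := by
  let C (q : Metric.sphere (0 : Y → X → ℂ) 1 × (ι → Y × Y → ℂ)) (i : ι) : Matrix Y X ℂ :=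
    (Matrix.of fun a b => q.2 i (a, b)) * Matrix.of q.1.1
  have hC (i : ι) : Continuous fun q => C q i := by
    refine Continuous.matrix_mul (continuous_matrix fun a b => ?_) (continuous_matrix fun a b => ?_)
    · exact (continuous_apply_apply i (a, b)).comp continuous_snd
    · exact (continuous_apply_apply a b).comp (continuous_subtype_val.comp continuous_fst)
  have hclosed : IsClosed {q | ∀ i j, (C q i)ᴴ * C q j ∈ ℂ ∙ (1 : Matrix X X ℂ)} := by
    simp only [Set.ofPred_forall]
    exact isClosed_iInter fun i => isClosed_iInter fun j =>
      (Submodule.closed_of_finiteDimensional _).preimage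
        ((hC i).matrix_conjTranspose.matrix_mul (hC j))
  convert isClosedMap_snd_of_compactSpace _ hclosed using 1
  ext z
  simp only [Set.mem_ofPred_eq, Set.mem_image, Prod.exists, exists_eq_right,
    Submodule.mem_span_singleton]
  constructor
  · rintro ⟨V, hV0, hV⟩
    let v : Y → X → ℂ := V
    have hv : ‖v‖ ≠ 0 := norm_ne_zero_iff.mpr hV0
    refine ⟨⟨((‖v‖ : ℂ)⁻¹) • v, ?_⟩, fun i j => ?_⟩
    · rw [mem_sphere_zero_iff_norm, norm_smul, norm_inv, Complex.norm_real, norm_norm,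
        inv_mul_cancel₀ hv]
    · obtain ⟨c, hc⟩ := hV i j
      refine ⟨(‖v‖ : ℂ)⁻¹ * (star (‖v‖ : ℂ)⁻¹ * c), ?_⟩
      have hsm : Matrix.of ((‖v‖ : ℂ)⁻¹ • v) = (‖v‖ : ℂ)⁻¹ • V := rfl
      simp only [C, hsm, Matrix.mul_smul, Matrix.conjTranspose_smul, Matrix.smul_mul, hc,
        smul_smul]
  · rintro ⟨⟨v, hv⟩, h⟩
    refine ⟨Matrix.of v, ?_, fun i j => (h i j).imp fun c hc => hc.symm⟩
    rintro h0
    have : v = 0 := h0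
    simp [this] at hv

/-- Positive rank-one matrices span all matrices, by polarization. -/
lemma span_vecMulVec_star_self (n : Type*) [Fintype n] [DecidableEq n] :
    Submodule.span ℂ (Set.range fun d : n → ℂ => Matrix.vecMulVec (star d) d) = ⊤ := by
  rw [eq_top_iff]
  have hmem (d : n → ℂ) : Matrix.vecMulVec (star d) d ∈
      Submodule.span ℂ (Set.range fun d : n → ℂ => Matrix.vecMulVec (star d) d) :=
    Submodule.subset_span ⟨d, rfl⟩
  have hpol (v w : n → ℂ) : Matrix.vecMulVec (star v) w ∈
      Submodule.span ℂ (Set.range fun d : n → ℂ => Matrix.vecMulVec (star d) d) := by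
    have h : Matrix.vecMulVec (star v) w = (4⁻¹ : ℂ) •
        (Matrix.vecMulVec (star (v + w)) (v + w) - Matrix.vecMulVec (star (v - w)) (v - w) -
          Complex.I • (Matrix.vecMulVec (star (v + Complex.I • w)) (v + Complex.I • w) -
            Matrix.vecMulVec (star (v - Complex.I • w)) (v - Complex.I • w))) := by
      ext a b
      simp [Matrix.vecMulVec_apply]
      ring_nf
      simp
      ring
    rw [h]
    exact Submodule.smul_mem _ _ (Submodule.sub_mem _ (Submodule.sub_mem _ (hmem _) (hmem _))
      (Submodule.smul_mem _ _ (Submodule.sub_mem _ (hmem _) (hmem _))))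
  intro A _
  rw [Matrix.matrix_eq_sum_single A]
  refine Submodule.sum_mem _ fun i _ => Submodule.sum_mem _ fun j _ => ?_
  convert Submodule.smul_mem _ (A i j) (hpol (Pi.single i 1) (Pi.single j 1)) using 1
  ext a b
  simp [Matrix.vecMulVec_apply, Matrix.single_apply, Pi.single_apply, ite_and, eq_comm]
  split_ifs <;> rfl

/-- If `Nᴴ * N` is a scalar and `N` has a nontrivial kernel, then `N = 0`. -/
lemma eq_zero_of_conjTranspose_mul_self_eq_smul_one {X Y : Type*} [Fintype X] [Fintype Y]
    [DecidableEq X] {N : Matrix Y X ℂ} {c : ℂ} (h : Nᴴ * N = c • (1 : Matrix X X ℂ))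
    {x : X → ℂ} (hx : x ≠ 0) (hNx : N *ᵥ x = 0) : N = 0 := by
  have h1 : (Nᴴ * N) *ᵥ x = 0 := by rw [← Matrix.mulVec_mulVec, hNx, Matrix.mulVec_zero]
  rw [h, Matrix.smul_mulVec, Matrix.one_mulVec, smul_eq_zero] at h1
  rw [← Matrix.conjTranspose_mul_self_eq_zero, h, h1.resolve_right hx, zero_smul]

/-- A basis of positive rank-one matrices, with its dual basis written in coordinates. -/
lemma exists_dual_vecMulVec_star_self (n : Type*) [Fintype n] [DecidableEq n] :
    ∃ (d : n × n → n → ℂ) (a : n × n → n → n → ℂ), ∀ k l,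
      ∑ i, ∑ j, a k i j * (star (d l i) * d l j) = if l = k then 1 else 0 := by
  let b := Module.Basis.ofSpan (span_vecMulVec_star_self n).ge
  have := FiniteDimensional.fintypeBasisIndex b
  obtain ⟨e⟩ : Nonempty (_ ≃ n × n) := Fintype.card_eq.mp <| by
    rw [← Module.finrank_eq_card_basis b, Module.finrank_matrix, Module.finrank_self, mul_one,
      Fintype.card_prod]
  have hb (l : n × n) : ∃ d : n → ℂ, Matrix.vecMulVec (star d) d = b (e.symm l) :=
    Set.mem_range.mp (Module.Basis.ofSpan_subset (span_vecMulVec_star_self n).ge ⟨e.symm l, rfl⟩)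
  choose d hd using hb
  refine ⟨d, fun k i j => b.coord (e.symm k) (Matrix.single i j 1), fun k l => ?_⟩
  have h1 : b.coord (e.symm k) (Matrix.vecMulVec (star (d l)) (d l)) = if l = k then 1 else 0 := by
    rw [hd, Module.Basis.coord_apply, Module.Basis.repr_self, Finsupp.single_apply]
    simp only [EmbeddingLike.apply_eq_iff_eq]
  rw [← h1, Matrix.matrix_eq_sum_single (Matrix.vecMulVec _ _), map_sum]
  refine Finset.sum_congr rfl fun i _ => ?_
  rw [map_sum]
  refine Finset.sum_congr rfl fun j _ => ?_
  have : Matrix.single i j (Matrix.vecMulVec (star (d l)) (d l) i j) =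
      (star (d l i) * d l j) • Matrix.single i j (1 : ℂ) := by
    simp [Matrix.vecMulVec_apply]
  rw [this, map_smul, smul_eq_mul, mul_comm]

/-- Diagonal operators without scalar compressions: `Y` is split into `card ι ^ 2` blocks of size
less than `card X`, and the `(G i)ᴴ * G j` span the projections onto the blocks. -/
lemma exists_not_hasScalarCompression {ι X Y : Type*} [Fintype ι] [Fintype X] [Fintype Y]
    [DecidableEq X] (hX : 1 ≤ Fintype.card X)
    (hcard : Fintype.card Y ≤ Fintype.card ι ^ 2 * (Fintype.card X - 1)) :
    ∃ G : ι → Matrix Y Y ℂ, ¬ HasScalarCompression X G := by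
  classical
  obtain ⟨d, a, hda⟩ := exists_dual_vecMulVec_star_self ι
  obtain ⟨f⟩ : Nonempty (Y ↪ (ι × ι) × Fin (Fintype.card X - 1)) := by
    apply Function.Embedding.nonempty_of_card_le
    rwa [Fintype.card_prod, Fintype.card_fin, Fintype.card_prod, ← sq]
  refine ⟨fun i => Matrix.diagonal fun y => d (f y).1 i, ?_⟩
  rintro ⟨V, hV0, hV⟩
  choose c hc using hV
  apply hV0
  -- `N k` is `V` followed by the projection onto the block `k`
  let N (k : ι × ι) : Matrix Y X ℂ := Matrix.of fun y x => if (f y).1 = k then V y x else 0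
  have hentry (i j : ι) (x x' : X) : (c i j • (1 : Matrix X X ℂ)) x x' =
      ∑ y, star (d (f y).1 i) * d (f y).1 j * (star (V y x) * V y x') := by
    rw [← hc]
    simp only [Matrix.mul_apply (M := (_)ᴴ), Matrix.conjTranspose_apply, Matrix.diagonal_mul,
      star_mul']
    exact Finset.sum_congr rfl fun y _ => by ring
  have hscalar (k : ι × ι) : (N k)ᴴ * N k = (∑ i, ∑ j, a k i j * c i j) • (1 : Matrix X X ℂ) := by
    ext x x'
    calc ((N k)ᴴ * N k) x x'
        = ∑ y, (if (f y).1 = k then 1 else 0) * (star (V y x) * V y x') := by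
          rw [Matrix.mul_apply]
          refine Finset.sum_congr rfl fun y _ => ?_
          by_cases hy : (f y).1 = k <;> simp [N, hy]
      _ = ∑ i, ∑ j, a k i j *
            ∑ y, star (d (f y).1 i) * d (f y).1 j * (star (V y x) * V y x') := by
          simp only [← hda, Finset.sum_mul, Finset.mul_sum]
          rw [Finset.sum_comm]
          refine Finset.sum_congr rfl fun i _ => ?_
          rw [Finset.sum_comm]
          simp only [mul_assoc]
      _ = _ := by
          simp only [← hentry]
          simp only [Matrix.smul_apply, smul_eq_mul, Finset.sum_mul, mul_assoc]
  have hN (k : ι × ι) : N k = 0 := by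
    let L : (X → ℂ) →ₗ[ℂ] ({y // (f y).1 = k} → ℂ) :=
      (V.submatrix (Subtype.val : {y // (f y).1 = k} → Y) id).mulVecLin
    have hfib : Fintype.card {y // (f y).1 = k} ≤ Fintype.card X - 1 := by
      refine (Fintype.card_le_of_injective (fun y : {y // (f y).1 = k} => (f y.1).2)
        fun y y' h => ?_).trans_eq (Fintype.card_fin _)
      exact Subtype.ext (f.injective (Prod.ext (y.2.trans y'.2.symm) h))
    have hker : LinearMap.ker L ≠ ⊥ := by
      apply LinearMap.ker_ne_bot_of_finrank_lt
      rw [Module.finrank_fintype_fun_eq_card, Module.finrank_fintype_fun_eq_card]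
      omega
    obtain ⟨x, hx, hx0⟩ := Submodule.exists_mem_ne_zero_of_ne_bot hker
    refine eq_zero_of_conjTranspose_mul_self_eq_smul_one (hscalar k) hx0 ?_
    ext y
    by_cases hy : (f y).1 = k
    · have : (V *ᵥ x) y = 0 := congrFun (LinearMap.mem_ker.mp hx) ⟨y, hy⟩
      simpa [N, hy, Matrix.mulVec, dotProduct] using this
    · simp [N, hy, Matrix.mulVec, dotProduct]
  ext y x
  simpa [N] using congrFun (congrFun (hN (f y).1) y) x

/-! ### The two implications -/

theorem theorem6 {X Y Ω : Type*} [Fintype X] [Fintype Y] [DecidableEq Y]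
    (hX : 2 ≤ Fintype.card X) [MeasurableSpace Ω] (P : Measure Ω) [IsProbabilityMeasure P]
    (r : ℕ) (hr : 1 ≤ r) (G : Fin r → Ω → Matrix Y Y ℂ)
    (hG : ∀ i, IsGinibre (G i) P)
    (hindep : iIndepFun (fun i ω (q : Y × Y) => G i ω q.1 q.2) P) :
    ((r : ℝ) < (Fintype.card X : ℝ) * Fintype.card Y / ((Fintype.card X : ℝ) ^ 2 - 1) →
      ∀ᵐ ω ∂P, normalizedKraus (fun i => G i ω) ∈ probCorrectable X Y) ∧
    ((∀ᵐ ω ∂P, normalizedKraus (fun i => G i ω) ∈ perfCorrectable X Y) →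
      (r : ℝ) < √((Fintype.card Y : ℝ) / ((Fintype.card X : ℝ) - 1))) := by
  classical
  have hlaw := hasLaw_ginibreLaw hG hindep
  have : Nonempty X := Fintype.card_pos_iff.mp (by omega)
  have : Nonempty (Fin r) := ⟨⟨0, hr⟩⟩
  have hX' : (2 : ℝ) ≤ Fintype.card X := by exact_mod_cast hX
  have hr' : (1 : ℝ) ≤ r := by exact_mod_cast hr
  constructor
  · intro h
    rw [lt_div_iff₀ (by nlinarith)] at h
    have hX1 : 0 ≤ (Fintype.card X : ℝ) ^ 2 - 1 := by nlinarith
    have hXY : Fintype.card X ≤ Fintype.card Y := by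
      have h1 : Fintype.card X * Fintype.card X < Fintype.card X * Fintype.card Y + 1 := by
        have : (Fintype.card X : ℝ) * Fintype.card X < Fintype.card X * Fintype.card Y + 1 := by
          nlinarith
        exact_mod_cast this
      exact Nat.le_of_mul_le_mul_left (Nat.lt_succ_iff.mp h1) (by omega)
    have hcard : Fintype.card (Fin r) * (Fintype.card X * Fintype.card X) <
        Fintype.card (Fin r) + Fintype.card X * Fintype.card Y := by
      rw [Fintype.card_fin]
      have : (r : ℝ) * (Fintype.card X * Fintype.card X) <
        r + Fintype.card X * Fintype.card Y := by linarith
      exact_mod_cast this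
    have hae := ae_mem_probCorrectable (ι := Fin r) hXY hcard
    rw [← hlaw.map_eq] at hae
    exact ae_of_ae_map hlaw.aemeasurable hae
  · intro h
    by_contra hlt
    rw [Real.lt_sqrt (by positivity), lt_div_iff₀ (by linarith), not_lt] at hlt
    have hcard : Fintype.card Y ≤ Fintype.card (Fin r) ^ 2 * (Fintype.card X - 1) := by
      rw [Fintype.card_fin]
      have hsub : ((Fintype.card X - 1 : ℕ) : ℝ) = (Fintype.card X : ℝ) - 1 := by
        rw [Nat.cast_sub (by omega), Nat.cast_one]
      rw [← hsub] at hlt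
      exact_mod_cast hlt
    obtain ⟨G₀, hG₀⟩ := exists_not_hasScalarCompression (X := X) (by omega) hcard
    let U : Set (Fin r → Y × Y → ℂ) :=
      {z | HasScalarCompression X fun i => Matrix.of fun a b => z i (a, b)}ᶜ
    have hU : IsOpen U := (isClosed_hasScalarCompression (Fin r) X Y).isOpen_compl
    have hpos : ginibreLaw (Fin r) Y U ≠ 0 :=
      (hU.measure_pos _ ⟨fun i q => G₀ i q.1 q.2, hG₀⟩).ne'
    rw [← hlaw.map_eq, Measure.map_apply_of_aemeasurable hlaw.aemeasurable hU.measurableSet] at hpos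
    refine hpos (measure_mono_null (fun ω hω => ?_) (ae_iff.mp h))
    exact fun hmem => hω (hasScalarCompression_of_mem_perfCorrectable hmem)
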